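/- Let $X$ be a nonempty locally compact Polish space and let $G$ be a group of homeomorphisms of $X$ (under composition) such that it is not the case that both $G$ has exactly one element and $X$ has exactly two points. Let $\mathcal C(X,X)$ be the space of continuous maps $X\to X$ with the compact-open topology. A family $\mathcal F$ of maps $X\to X$ is *evenly continuous* if for all $x,y\in X$ and every neighbourhood $W$ of $y$ there are neighbourhoods $U$ of $x$ and $V$ of $y$ such that $f(U)\subset W$ whenever $f\in\mathcal F$ and $f(x)\in V$; it is *pointwise precompact* if for each $x\in X$ the closure of $\{f(x): f\in\mathcal F\}$ is compact. Assume: (Iso1) $G$ is closed in $\mathcal C(X,X)$; (Iso2) for every compact set $K\subset X$ the family $\{h\in G: h(K)\cap K\neq\varnothing\}$ is evenly continuous and pointwise precompact. Let $\widehat G$ denote the symmetrized 2-hull of $G$, i.e. the set of all functions $g\colon X\to X$ such that for any $x,y\in X$ there is $f\in G$ with $\{g(x),g(y)\}=\{f(x),f(y)\}$. Let $\mathrm{Metr}_c(X|G)$ be the set of all $G$-invariant metrics on $X$ which induce the topology of $X$ and all of whose closed balls are compact. For a metric $\varrho$ on $X$, let $\mathrm{Iso}(X,\varrho)$ be the group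 of all bijective isometries of $(X,\varrho)$. **Theorem.** For every $d\in\mathrm{Metr}_c(X|G)$ and every real $M>1$, the set $$\{\varrho\in\mathrm{Metr}_c(X|G):\ d\le\varrho\le Md,\ \mathrm{Iso}(X,\varrho)=\widehat G\}$$ is dense and $G_\delta$ in $$\Delta_G^M(d):=\{\varrho\in\mathrm{Metr}_c(X|G):\ d\le\varrho\le Md\},$$ where $\Delta_G^M(d)$ carries the topology of the metric $\Lambda_d$ for which $\Lambda_d(\varrho,\varrho')$ is the least constant $C\ge 0$ with $|\varrho-\varrho'|\le C\,d$ on $X\times X$. -/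

import Mathlib

namespace IsoHull

/-- A family `F` of functions `X → Y` is evenly continuous. -/
def EvenlyContinuous {X Y : Type*} [TopologicalSpace X] [TopologicalSpace Y]
    (F : Set (X → Y)) : Prop :=
  ∀ (x : X) (y : Y), ∀ W ∈ nhds y, ∃ U ∈ nhds x, ∃ V ∈ nhds y,
    ∀ f ∈ F, f x ∈ V → f '' U ⊆ W

/-- A family `F` of functions `X → Y` is pointwise precompact. -/
def PointwisePrecompact {X Y : Type*} [TopologicalSpace Y] (F : Set (X → Y)) : Prop :=
  ∀ x : X, IsCompact (closure ((fun f : X → Y => f x) '' F))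

/-- The symmetrized 2-hull of a family of functions. -/
def symmetrizedTwoHull {X Y : Type*} (F : Set (X → Y)) : Set (X → Y) :=
  {g | ∀ x y : X, ∃ f ∈ F, ({g x, g y} : Set Y) = {f x, f y}}

/-- The set of all maps `X → X` that belong to a group of homeomorphisms of `X`. -/
def mapsOf {X : Type*} [TopologicalSpace X] (G : Subgroup (X ≃ₜ X)) : Set (X → X) :=
  (fun g : X ≃ₜ X => (g : X → X)) '' (G : Set (X ≃ₜ X))

/-- (Iso1): `G` is closed in the space `C(X, X)` with the compact-open topology. -/
def Iso1 {X : Type*} [TopologicalSpace X] (G : Subgroup (X ≃ₜ X)) : Prop :=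
  IsClosed {f : C(X, X) | (f : X → X) ∈ mapsOf G}

/-- (Iso2): for every compact `K`, the family of all `h ∈ G` such that `h(K)` meets `K` is evenly
continuous and pointwise precompact. -/
def Iso2 {X : Type*} [TopologicalSpace X] (G : Subgroup (X ≃ₜ X)) : Prop :=
  ∀ K : Set X, IsCompact K →
    EvenlyContinuous {h ∈ mapsOf G | (h '' K ∩ K).Nonempty} ∧
    PointwisePrecompact {h ∈ mapsOf G | (h '' K ∩ K).Nonempty}

/-- `d` is a metric on the set `X`. -/
structure IsMetric {X : Type*} (d : X → X → ℝ) : Prop where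
  eq_zero_iff : ∀ x y, d x y = 0 ↔ x = y
  symm : ∀ x y, d x y = d y x
  triangle : ∀ x y z, d x z ≤ d x y + d y z

/-- `d` is a proper metric on `X` which induces the topology of `X`. -/
structure IsProperCompatibleMetric {X : Type*} [TopologicalSpace X] (d : X → X → ℝ) : Prop
    extends IsMetric d where
  isOpen_iff : ∀ s : Set X, IsOpen s ↔ ∀ x ∈ s, ∃ ε > 0, {y | d x y < ε} ⊆ s
  isCompact_closedBall : ∀ (x : X) (r : ℝ), IsCompact {y | d x y ≤ r}

/-- `d` is `G`-invariant. -/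
def IsInvariant {X : Type*} [TopologicalSpace X] (G : Subgroup (X ≃ₜ X)) (d : X → X → ℝ) : Prop :=
  ∀ g ∈ G, ∀ x y : X, d (g x) (g y) = d x y

/-- The set of all `G`-invariant proper metrics inducing the topology of `X`. -/
def invariantMetrics {X : Type*} [TopologicalSpace X] (G : Subgroup (X ≃ₜ X)) :
    Set (X → X → ℝ) :=
  {d | IsProperCompatibleMetric d ∧ IsInvariant G d}

/-- The (underlying set of the) group of all bijective isometries of `(X, d)`. -/
def isometries {X : Type*} (d : X → X → ℝ) : Set (X → X) :=
  {g | Function.Bijective g ∧ ∀ x y : X, d (g x) (g y) = d x y}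

/-- The space of all metrics `ρ` such that `d ≤ ρ ≤ M d` for some constant `M > 1`. -/
@[ext]
structure Delta {X : Type*} (d : X → X → ℝ) where
  toFun : X → X → ℝ
  isMetric : IsMetric toFun
  exists_bound : ∃ M : ℝ, 1 < M ∧ ∀ x y, d x y ≤ toFun x y ∧ toFun x y ≤ M * d x y

/-- The least nonnegative constant `C` such that `|ρ - ρ'| ≤ C d`. -/
noncomputable def Lam {X : Type*} (d ρ ρ' : X → X → ℝ) : ℝ :=
  sInf {C : ℝ | 0 ≤ C ∧ ∀ x y, |ρ x y - ρ' x y| ≤ C * d x y}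

/-- On `Delta d` the least constant is attained, so that the infimum is a minimum. -/
theorem Lam_isLeast {X : Type*} {d : X → X → ℝ} (ρ ρ' : Delta d) :
    IsLeast {C : ℝ | 0 ≤ C ∧ ∀ x y, |ρ.toFun x y - ρ'.toFun x y| ≤ C * d x y}
      (Lam d ρ.toFun ρ'.toFun) := by
  obtain ⟨M, hM, h⟩ := ρ.exists_bound
  obtain ⟨M', hM', h'⟩ := ρ'.exists_bound
  have hbdd : BddBelow {C : ℝ | 0 ≤ C ∧ ∀ x y, |ρ.toFun x y - ρ'.toFun x y| ≤ C * d x y} :=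
    ⟨0, fun C hC => hC.1⟩
  have hne : {C : ℝ | 0 ≤ C ∧ ∀ x y, |ρ.toFun x y - ρ'.toFun x y| ≤ C * d x y}.Nonempty := by
    refine ⟨M + M', by linarith, fun x y => ?_⟩
    have h1 := h x y
    have h2 := h' x y
    have hd : 0 ≤ d x y := by nlinarith
    rw [abs_le]
    constructor <;> nlinarith [mul_nonneg (by linarith : (0 : ℝ) ≤ M) hd,
      mul_nonneg (by linarith : (0 : ℝ) ≤ M') hd]
  have hclosed : IsClosed {C : ℝ | 0 ≤ C ∧ ∀ x y, |ρ.toFun x y - ρ'.toFun x y| ≤ C * d x y} := by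
    simp only [Set.ofPred_and, Set.ofPred_forall]
    refine isClosed_Ici.inter (isClosed_iInter fun x => isClosed_iInter fun y => ?_)
    exact isClosed_le continuous_const (by fun_prop)
  exact ⟨hclosed.csInf_mem hne hbdd, fun C hC => csInf_le hbdd hC⟩

/-- `Delta d` is equipped with the metric `Lam d`. -/
noncomputable instance {X : Type*} (d : X → X → ℝ) : MetricSpace (Delta d) where
  dist ρ ρ' := Lam d ρ.toFun ρ'.toFun
  dist_self ρ := le_antisymm ((Lam_isLeast ρ ρ).2 (by simp)) (Lam_isLeast ρ ρ).1.1
  dist_comm ρ ρ' := by simp only [Lam, abs_sub_comm]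
  dist_triangle ρ₁ ρ₂ ρ₃ := by
    have h := (Lam_isLeast ρ₁ ρ₂).1
    have h' := (Lam_isLeast ρ₂ ρ₃).1
    refine (Lam_isLeast ρ₁ ρ₃).2 ⟨add_nonneg h.1 h'.1, fun x y => ?_⟩
    rw [add_mul]
    exact (abs_sub_le _ (ρ₂.toFun x y) _).trans (add_le_add (h.2 x y) (h'.2 x y))
  eq_of_dist_eq_zero := by
    intro ρ ρ' h0
    have h := (Lam_isLeast ρ ρ').1.2
    ext x y
    have hxy := h x y
    change Lam d ρ.toFun ρ'.toFun = 0 at h0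
    rw [h0, zero_mul] at hxy
    exact sub_eq_zero.1 (abs_nonpos_iff.1 hxy)

/-- The subset of `Delta d` of all `G`-invariant proper metrics `ρ` inducing the topology of `X`
such that `ρ ≤ M d`. -/
def DeltaGM {X : Type*} [TopologicalSpace X] (G : Subgroup (X ≃ₜ X)) (d : X → X → ℝ) (M : ℝ) :
    Set (Delta d) :=
  {ρ | ρ.toFun ∈ invariantMetrics G ∧ ∀ x y, ρ.toFun x y ≤ M * d x y}

end IsoHull

open Set Filter Topology

namespace IsoHull

/-! ### Shortcuts in metrics, and the concave function `cap` -/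

section Metric

variable {X : Type*}

/-! The proof is a Baire category argument in the complete space of invariant metrics between `d`
and `M * d`. Every such metric is preserved by the symmetrized hull. Conversely, an isometry outside
the hull moves some pair of distinct points to a pair outside its orbit; on the diagonal this uses
the excluded exceptional case (`mem_symmetrizedTwoHull_of_ne`). By the Lindelöf property, countably
many sets `transporting` cover all the bad metrics. Each is closed, because isometries of these
metrics are uniformly Lipschitz for `d`, so limits exist in a proper space
(`isClosed_transporting`).

It remains to see that each complement is dense. After a small change making the triangle inequality
strict (`IsAdmissible.exists_strict`), all pairs in the orbit of `(a, b)` are shortened by `η`, and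
the shortcuts are propagated through the space (`IsAdmissible.exists_shortcut`). Pairs near `(a, b)`
but off its orbit then have a point metrically between them, while pairs away from the orbit have
none. Betweenness is invariant under isometries, so no isometry moves the first kind to the second.
If neither orbit is accumulated by pairs outside it, the lengths of the two orbits are made
different instead. -/

theorem IsMetric.self_eq_zero {ρ : X → X → ℝ} (h : IsMetric ρ) (x : X) : ρ x x = 0 :=
  (h.eq_zero_iff x x).2 rfl

theorem IsMetric.nonneg {ρ : X → X → ℝ} (h : IsMetric ρ) (x y : X) : 0 ≤ ρ x y := by
  have h1 := h.triangle x y x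
  rw [h.self_eq_zero, h.symm y x] at h1
  linarith

/-- Adding shortcuts to a metric gives a metric if using two shortcuts in a row does not pay. -/
theorem IsMetric.min_shortcut {ρ c : X → X → ℝ} (h : IsMetric ρ) (hpos : ∀ x y, 0 < c x y)
    (hsymm : ∀ x y, c x y = c y x) (h1 : ∀ x y z, c x z ≤ c x y + ρ y z)
    (h2 : ∀ x y z, ρ x z ≤ c x y + c y z) : IsMetric fun x y => min (ρ x y) (c x y) where
  eq_zero_iff x y := by
    refine ⟨fun h0 => ?_, ?_⟩
    · rcases min_choice (ρ x y) (c x y) with h' | h'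
      · exact (h.eq_zero_iff x y).1 (h'.symm.trans h0)
      · exact absurd (h'.symm.trans h0) (hpos x y).ne'
    · rintro rfl
      simp only [h.self_eq_zero]
      exact min_eq_left (hpos x x).le
  symm x y := by simp only [h.symm x y, hsymm x y]
  triangle x y z := by
    rcases min_choice (ρ x y) (c x y) with h' | h' <;>
      rcases min_choice (ρ y z) (c y z) with h'' | h'' <;> simp only [h', h'']
    · exact (min_le_left _ _).trans (h.triangle x y z)
    · refine (min_le_right _ _).trans ?_
      have := h1 z y x
      rw [hsymm z x, hsymm z y, h.symm y x] at this
      linarith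
    · exact (min_le_right _ _).trans (h1 x y z)
    · exact (min_le_left _ _).trans (h2 x y z)

/-- The bounded concave function `t ↦ t / (1 + t)`. -/
noncomputable def cap (t : ℝ) : ℝ := t / (1 + t)

theorem cap_nonneg {t : ℝ} (ht : 0 ≤ t) : 0 ≤ cap t := div_nonneg ht (by linarith)

theorem cap_le_self {t : ℝ} (ht : 0 ≤ t) : cap t ≤ t := div_le_self ht (by linarith)

theorem cap_mono {s t : ℝ} (hs : 0 ≤ s) (hst : s ≤ t) : cap s ≤ cap t := by
  unfold cap
  rw [div_le_div_iff₀ (by linarith) (by linarith)]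
  nlinarith

/-- The defect of additivity of `cap`. -/
noncomputable def capDefect (s t : ℝ) : ℝ := cap s + cap t - cap (s + t)

theorem capDefect_eq {s t : ℝ} (hs : 0 ≤ s) (ht : 0 ≤ t) :
    capDefect s t = s * t * (2 + s + t) / ((1 + s) * (1 + t) * (1 + s + t)) := by
  unfold capDefect cap
  have h1 : 1 + s ≠ 0 := by positivity
  have h2 : 1 + t ≠ 0 := by positivity
  have h3 : 1 + s + t ≠ 0 := by positivity
  have h4 : 1 + (s + t) ≠ 0 := by positivity
  field_simp
  ring

theorem capDefect_nonneg {s t : ℝ} (hs : 0 ≤ s) (ht : 0 ≤ t) : 0 ≤ capDefect s t := by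
  rw [capDefect_eq hs ht]; positivity

theorem capDefect_pos {s t : ℝ} (hs : 0 < s) (ht : 0 < t) : 0 < capDefect s t := by
  rw [capDefect_eq hs.le ht.le]; positivity

/-- By concavity, the increment `cap (u + t) - cap u` decreases in `u`. -/
theorem capDefect_mono_left {s s' t : ℝ} (hs : 0 ≤ s) (hss' : s ≤ s') (ht : 0 ≤ t) :
    capDefect s t ≤ capDefect s' t := by
  have key : ∀ u : ℝ, 0 ≤ u → cap (u + t) - cap u = t / ((1 + u) * (1 + u + t)) := by
    intro u hu
    unfold cap
    have h1 : 1 + u ≠ 0 := by positivity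
    have h3 : 1 + u + t ≠ 0 := by positivity
    have h4 : 1 + (u + t) ≠ 0 := by positivity
    field_simp
    ring
  have h1 := key s hs
  have h2 := key s' (hs.trans hss')
  have h3 : t / ((1 + s') * (1 + s' + t)) ≤ t / ((1 + s) * (1 + s + t)) := by
    have : 0 ≤ 1 + s' := by linarith
    gcongr
  unfold capDefect
  linarith

end Metric

/-! ### Invariant metrics between `dist` and `M * dist` -/

section Admissible

variable {X : Type*} [MetricSpace X]

/-- `ρ` is a `G`-invariant metric with `dist ≤ ρ ≤ M * dist`. -/
structure IsAdmissible (G : Subgroup (X ≃ₜ X)) (M : ℝ) (ρ : X → X → ℝ) : Prop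
    extends IsMetric ρ where
  invariant : IsInvariant G ρ
  dist_le : ∀ x y, dist x y ≤ ρ x y
  le_mul : ∀ x y, ρ x y ≤ M * dist x y

variable {G : Subgroup (X ≃ₜ X)} {M : ℝ}

theorem IsAdmissible.abs_sub_le {ρ : X → X → ℝ} (h : IsAdmissible G M ρ) (x y x' y' : X) :
    |ρ x y - ρ x' y'| ≤ M * (dist x x' + dist y y') := by
  have h1 := h.triangle x x' y
  have h2 := h.triangle x' y' y
  have h3 := h.triangle x' x y'
  have h4 := h.triangle x y y'
  have h5 := h.le_mul x x'
  have h6 := h.le_mul y y'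
  rw [h.symm y' y] at h2
  rw [h.symm x' x] at h3
  rw [abs_le]
  constructor <;> linarith

theorem IsAdmissible.tendsto {ι : Type*} {l : Filter ι} {ρs : ι → X → X → ℝ} {ρ : X → X → ℝ}
    {x y : X} {xs ys : ι → X}
    (h : ∀ᶠ i in l, IsAdmissible G M (ρs i)) (hρ : Tendsto (fun i => ρs i x y) l (𝓝 (ρ x y)))
    (hx : Tendsto xs l (𝓝 x)) (hy : Tendsto ys l (𝓝 y)) :
    Tendsto (fun i => ρs i (xs i) (ys i)) l (𝓝 (ρ x y)) := by
  have h0 : Tendsto (fun i => M * (dist (xs i) x + dist (ys i) y)) l (𝓝 0) := by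
    have := ((tendsto_iff_dist_tendsto_zero.1 hx).add
      (tendsto_iff_dist_tendsto_zero.1 hy)).const_mul M
    simpa using this
  have h1 : Tendsto (fun i => ρs i (xs i) (ys i) - ρs i x y) l (𝓝 0) :=
    squeeze_zero_norm' (h.mono fun i hi => hi.abs_sub_le _ _ _ _) h0
  simpa using h1.add hρ

theorem IsAdmissible.continuous {ρ : X → X → ℝ} (h : IsAdmissible G M ρ) :
    Continuous fun p : X × X => ρ p.1 p.2 := by
  rw [continuous_iff_continuousAt]
  intro p
  exact IsAdmissible.tendsto (ρs := fun _ => ρ) (Eventually.of_forall fun _ => h)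
    tendsto_const_nhds continuous_fst.continuousAt continuous_snd.continuousAt

theorem IsAdmissible.isProperCompatibleMetric [ProperSpace X] {ρ : X → X → ℝ} (hM : 0 < M)
    (h : IsAdmissible G M ρ) : IsProperCompatibleMetric ρ where
  toIsMetric := h.toIsMetric
  isOpen_iff s := by
    rw [Metric.isOpen_iff]
    refine forall₂_congr fun x _ => ⟨?_, ?_⟩
    · rintro ⟨ε, hε, hs⟩
      refine ⟨ε, hε, fun y hy => hs ?_⟩
      rw [Metric.mem_ball']
      exact (h.dist_le x y).trans_lt hy
    · rintro ⟨ε, hε, hs⟩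
      refine ⟨ε / M, div_pos hε hM, fun y hy => hs ?_⟩
      rw [Metric.mem_ball', lt_div_iff₀ hM] at hy
      have := h.le_mul x y
      change ρ x y < ε
      linarith
  isCompact_closedBall x r := by
    refine (isCompact_closedBall x r).of_isClosed_subset ?_ fun y hy => ?_
    · exact isClosed_le (h.continuous.comp (Continuous.prodMk_right x)) continuous_const
    · rw [Metric.mem_closedBall']
      exact (h.dist_le x y).trans hy

/-- An admissible metric as an element of `DeltaGM`. -/
def IsAdmissible.toDelta [ProperSpace X] (hM : 1 < M) {ρ : X → X → ℝ} (h : IsAdmissible G M ρ) :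
    DeltaGM G (fun x y : X => dist x y) M :=
  ⟨⟨ρ, h.toIsMetric, M, hM, fun x y => ⟨h.dist_le x y, h.le_mul x y⟩⟩,
    ⟨h.isProperCompatibleMetric (by linarith), h.invariant⟩, h.le_mul⟩

theorem isAdmissible_coe (ρ : DeltaGM G (fun x y : X => dist x y) M) :
    IsAdmissible G M ρ.1.toFun where
  toIsMetric := ρ.1.isMetric
  invariant := ρ.2.1.2
  dist_le x y := by
    obtain ⟨_, _, h⟩ := ρ.1.exists_bound
    exact (h x y).1
  le_mul := ρ.2.2

theorem abs_sub_le_dist_mul (ρ ρ' : DeltaGM G (fun x y : X => dist x y) M) (x y : X) :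
    |ρ.1.toFun x y - ρ'.1.toFun x y| ≤ dist ρ ρ' * dist x y :=
  (Lam_isLeast ρ.1 ρ'.1).1.2 x y

theorem dist_le_of_abs_sub_le {ρ ρ' : DeltaGM G (fun x y : X => dist x y) M} {C : ℝ} (hC : 0 ≤ C)
    (h : ∀ x y, |ρ.1.toFun x y - ρ'.1.toFun x y| ≤ C * dist x y) : dist ρ ρ' ≤ C :=
  (Lam_isLeast ρ.1 ρ'.1).2 ⟨hC, h⟩

/-- Pointwise limits keep both bounds, and the lower bound keeps distinct points apart. Completeness
is what Baire's theorem needs. -/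
theorem completeSpace_deltaGM [ProperSpace X] (hM : 1 < M) :
    CompleteSpace (DeltaGM G (fun x y : X => dist x y) M) := by
  refine Metric.complete_of_cauchySeq_tendsto fun u hu => ?_
  have hadm n := isAdmissible_coe (u n)
  have hlim : ∀ x y, ∃ v, Tendsto (fun n => (u n).1.toFun x y) atTop (𝓝 v) := by
    intro x y
    refine cauchySeq_tendsto_of_complete (Metric.cauchySeq_iff'.2 fun ε hε => ?_)
    obtain ⟨N, hN⟩ := Metric.cauchySeq_iff'.1 hu (ε / (dist x y + 1)) (by positivity)
    refine ⟨N, fun n hn => (abs_sub_le_dist_mul (u n) (u N) x y).trans_lt ?_⟩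
    have h1 := hN n hn
    rw [lt_div_iff₀ (by positivity)] at h1
    nlinarith [dist_nonneg (x := u n) (y := u N)]
  choose ρ hρ using hlim
  have had : IsAdmissible G M ρ :=
    { eq_zero_iff := fun x y => by
        refine ⟨fun h0 => ?_, ?_⟩
        · have := ge_of_tendsto' (hρ x y) fun n => (hadm n).dist_le x y
          exact dist_le_zero.1 (this.trans h0.le)
        · rintro rfl
          refine tendsto_nhds_unique (hρ x x) ?_
          simp only [(hadm _).self_eq_zero]
          exact tendsto_const_nhds
      symm := fun x y => by
        refine tendsto_nhds_unique (hρ x y) ?_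
        simp only [(hadm _).symm x y]
        exact hρ y x
      triangle := fun x y z =>
        le_of_tendsto_of_tendsto' (hρ x z) ((hρ x y).add (hρ y z)) fun n => (hadm n).triangle x y z
      invariant := fun g hg x y => by
        refine tendsto_nhds_unique (hρ (g x) (g y)) ?_
        simp only [(hadm _).invariant g hg x y]
        exact hρ x y
      dist_le := fun x y => ge_of_tendsto' (hρ x y) fun n => (hadm n).dist_le x y
      le_mul := fun x y => le_of_tendsto' (hρ x y) fun n => (hadm n).le_mul x y }
  refine ⟨had.toDelta hM, Metric.tendsto_atTop.2 fun ε hε => ?_⟩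
  obtain ⟨N, hN⟩ := Metric.cauchySeq_iff.1 hu (ε / 2) (by positivity)
  refine ⟨N, fun n hn => (dist_le_of_abs_sub_le (C := ε / 2) (by positivity) fun x y => ?_).trans_lt
    (by linarith)⟩
  refine le_of_tendsto (((hρ x y).const_sub _).abs) (eventually_atTop.2 ⟨N, fun m hm => ?_⟩)
  refine (abs_sub_le_dist_mul (u n) (u m) x y).trans ?_
  have := hN n hn m hm
  gcongr

/-- A self-isometry of a proper metric space with a fixed point is surjective. -/
theorem surjective_of_isometry_of_fixed [ProperSpace X] {φ : X → X} (hφ : Isometry φ) {x : X}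
    (hx : φ x = x) : Function.Surjective φ := by
  intro y
  set K := Metric.closedBall x (dist y x)
  have hK : IsCompact K := isCompact_closedBall _ _
  have hmaps : MapsTo φ K K := fun z hz => by
    rw [Metric.mem_closedBall] at hz ⊢
    rwa [← hx, hφ.dist_eq, hx]
  have hmem : ∀ n, φ^[n] y ∈ K := fun n => hmaps.iterate n (Metric.mem_closedBall.2 le_rfl)
  suffices h : y ∈ closure (φ '' K) by
    rw [(hK.image hφ.continuous).isClosed.closure_eq] at h
    exact ⟨h.choose, h.choose_spec.2⟩
  rw [Metric.mem_closure_iff]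
  intro ε hε
  obtain ⟨z, -, θ, hθ, hlim⟩ := hK.tendsto_subseq hmem
  obtain ⟨N, hN⟩ := Metric.cauchySeq_iff.1 hlim.cauchySeq ε hε
  -- Two iterates of `y` are close; cancelling the earlier one, an isometry, brings `y` close to a
  -- positive iterate of itself, hence to `φ '' K`.
  have h1 := hN N le_rfl (N + 1) (Nat.le_succ N)
  obtain ⟨k, hk⟩ := Nat.exists_eq_add_of_lt (hθ (Nat.lt_succ_self N))
  refine ⟨φ (φ^[k] y), mem_image_of_mem φ (hmem k), ?_⟩
  simp only [Function.comp_apply] at h1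
  have hiter : ∀ n, Isometry φ^[n] := fun n => by
    induction n with
    | zero => exact isometry_id
    | succ n ih => exact ih.comp hφ
  rw [Nat.succ_eq_add_one] at hk
  rw [hk, add_assoc, Function.iterate_add_apply, (hiter _).dist_eq,
    Function.iterate_succ_apply'] at h1
  exact h1

theorem isometry_of_mem (hG : IsInvariant G (fun x y : X => dist x y)) {f : X ≃ₜ X}
    (hf : f ∈ G) : Isometry f :=
  Isometry.of_dist_eq (hG f hf)

/-- On each pair `g` agrees with an element of `G` up to a swap, which a symmetric function does not
see. Surjectivity follows because composing `g` with some `f⁻¹` gives an isometry with a fixed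
point. -/
theorem symmetrizedTwoHull_subset_isometries [ProperSpace X] [Nonempty X]
    (hG : IsInvariant G (fun x y : X => dist x y)) {ρ : X → X → ℝ} (hρ : IsMetric ρ)
    (hinv : IsInvariant G ρ) : symmetrizedTwoHull (mapsOf G) ⊆ isometries ρ := by
  intro g hg
  have key : ∀ σ : X → X → ℝ, (∀ x y, σ x y = σ y x) → IsInvariant G σ →
      ∀ x y, σ (g x) (g y) = σ x y := by
    intro σ hσ hi x y
    obtain ⟨_, ⟨f, hf, rfl⟩, h⟩ := hg x y
    rcases Set.pair_eq_pair_iff.1 h with ⟨h1, h2⟩ | ⟨h1, h2⟩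
    · rw [h1, h2, hi f hf]
    · rw [h1, h2, hi f hf, hσ]
  refine ⟨⟨?_, ?_⟩, key ρ hρ.symm hinv⟩
  · intro x y hxy
    have h := key ρ hρ.symm hinv x y
    rw [hxy, hρ.self_eq_zero] at h
    exact (hρ.eq_zero_iff x y).1 h.symm
  · obtain ⟨x⟩ := ‹Nonempty X›
    obtain ⟨_, ⟨f, hf, rfl⟩, h⟩ := hg x x
    have hx : g x = f x := by simpa using h
    have hiso : Isometry (f.symm ∘ g) :=
      (isometry_of_mem hG (G.inv_mem hf)).comp (Isometry.of_dist_eq (key _ dist_comm hG))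
    have hsurj := surjective_of_isometry_of_fixed hiso (x := x) (by simp [hx])
    exact (Function.Surjective.of_comp_iff' f.symm.bijective g).1 hsurj

end Admissible

/-! ### Orbits of unordered pairs and the symmetrized hull -/

section Orbit

variable {X : Type*} [TopologicalSpace X] {G : Subgroup (X ≃ₜ X)}

/-- The orbit of the unordered pair `{a, b}` under `G`, as a symmetric set of ordered pairs. -/
def pairOrbit (G : Subgroup (X ≃ₜ X)) (a b : X) : Set (X × X) :=
  {p | ∃ f ∈ G, p = (f a, f b) ∨ p = (f b, f a)}

theorem mem_pairOrbit_self (a b : X) : (a, b) ∈ pairOrbit G a b :=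
  ⟨1, G.one_mem, Or.inl rfl⟩

theorem pairOrbit_swap {a b u v : X} (h : (u, v) ∈ pairOrbit G a b) :
    (v, u) ∈ pairOrbit G a b := by
  obtain ⟨f, hf, h | h⟩ := h <;> rw [Prod.mk.injEq] at h <;> obtain ⟨rfl, rfl⟩ := h
  · exact ⟨f, hf, Or.inr rfl⟩
  · exact ⟨f, hf, Or.inl rfl⟩

theorem pairOrbit_smul {a b u v : X} (h : (u, v) ∈ pairOrbit G a b) {g : X ≃ₜ X} (hg : g ∈ G) :
    (g u, g v) ∈ pairOrbit G a b := by
  obtain ⟨f, hf, h | h⟩ := h <;> rw [Prod.mk.injEq] at h <;> obtain ⟨rfl, rfl⟩ := h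
  · exact ⟨g * f, G.mul_mem hg hf, Or.inl rfl⟩
  · exact ⟨g * f, G.mul_mem hg hf, Or.inr rfl⟩

theorem pairOrbit_symm {a b u v : X} (h : (u, v) ∈ pairOrbit G a b) :
    (a, b) ∈ pairOrbit G u v := by
  obtain ⟨f, hf, h | h⟩ := h <;> rw [Prod.mk.injEq] at h <;> obtain ⟨rfl, rfl⟩ := h
  · exact ⟨f⁻¹, G.inv_mem hf, Or.inl (by
      rw [Prod.mk.injEq]; exact ⟨(f.symm_apply_apply a).symm, (f.symm_apply_apply b).symm⟩)⟩
  · exact ⟨f⁻¹, G.inv_mem hf, Or.inr (by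
      rw [Prod.mk.injEq]; exact ⟨(f.symm_apply_apply a).symm, (f.symm_apply_apply b).symm⟩)⟩

theorem eq_of_mem_pairOrbit {ρ : X → X → ℝ} (hinv : IsInvariant G ρ) (hs : ∀ x y, ρ x y = ρ y x)
    {a b u v : X} (h : (u, v) ∈ pairOrbit G a b) : ρ u v = ρ a b := by
  obtain ⟨f, hf, h | h⟩ := h <;> rw [Prod.mk.injEq] at h <;> obtain ⟨rfl, rfl⟩ := h
  · exact hinv f hf a b
  · rw [hinv f hf b a, hs]

theorem mem_symmetrizedTwoHull_iff {g : X → X} :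
    g ∈ symmetrizedTwoHull (mapsOf G) ↔ ∀ x y, (g x, g y) ∈ pairOrbit G x y := by
  refine forall₂_congr fun x y => ⟨?_, ?_⟩
  · rintro ⟨_, ⟨f, hf, rfl⟩, h⟩
    refine ⟨f, hf, ?_⟩
    simpa only [Prod.mk.injEq] using Set.pair_eq_pair_iff.1 h
  · rintro ⟨f, hf, h⟩
    refine ⟨f, ⟨f, hf, rfl⟩, Set.pair_eq_pair_iff.2 ?_⟩
    simpa only [Prod.mk.injEq] using h

/-- A bijection that preserves the orbits of pairs of distinct points belongs to the symmetrized
2-hull, unless the group is trivial and the space has exactly two points. -/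
theorem mem_symmetrizedTwoHull_of_ne (hcard : ¬ (Nat.card G = 1 ∧ Nat.card X = 2)) {g : X → X}
    (h : ∀ x y, x ≠ y → (g x, g y) ∈ pairOrbit G x y) :
    g ∈ symmetrizedTwoHull (mapsOf G) := by
  refine mem_symmetrizedTwoHull_iff.2 fun a y => ?_
  rcases ne_or_eq a y with hay | rfl
  · exact h a y hay
  by_contra hcon
  have hga : ∀ f ∈ G, g a ≠ f a := fun f hf he => hcon ⟨f, hf, Or.inl (by rw [he])⟩
  -- As `g a` is not in the orbit of `a`, every pair containing `a` must be swapped.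
  have hb : ∀ b, a ≠ b → ∃ f ∈ G, g a = f b ∧ g b = f a := by
    intro b hab
    obtain ⟨f, hf, h' | h'⟩ := h a b hab
    · exact absurd (Prod.mk.inj h').1 (hga f hf)
    · exact ⟨f, hf, Prod.mk.inj h'⟩
  -- With two further points `b` and `c`, the swaps for `(a, b)` and `(a, c)` combine with the
  -- element for `(b, c)` into one sending `a` to `g a`. So `X` has only one point besides `a`,
  -- which forces the exceptional case.
  have huniq : ∀ b c, a ≠ b → a ≠ c → b = c := by
    intro b c hab hac
    by_contra hbc
    obtain ⟨f, hf, h1, h2⟩ := hb b hab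
    obtain ⟨f', hf', h3, h4⟩ := hb c hac
    obtain ⟨k, hk, h' | h'⟩ := h b c hbc
    · have h5 := (Prod.mk.inj h').1
      rw [h2] at h5
      refine hga (f * k⁻¹ * f) (G.mul_mem (G.mul_mem hf (G.inv_mem hk)) hf) ?_
      change g a = f (k.symm (f a))
      rw [h5, k.symm_apply_apply, h1]
    · have h5 := (Prod.mk.inj h').1
      rw [h2] at h5
      refine hga (f' * k⁻¹ * f) (G.mul_mem (G.mul_mem hf' (G.inv_mem hk)) hf) ?_
      change g a = f' (k.symm (f a))
      rw [h5, k.symm_apply_apply, h3]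
  have hne : a ≠ g a := fun he => hga 1 G.one_mem he.symm
  have huniv : ∀ x, x = a ∨ x = g a := fun x => by
    by_cases hx : a = x
    · exact Or.inl hx.symm
    · exact Or.inr (huniq x (g a) hx hne)
  refine hcard ⟨?_, ?_⟩
  · rw [Nat.card_eq_one_iff_exists]
    refine ⟨1, fun ⟨f, hf⟩ => Subtype.ext (Homeomorph.ext fun x => ?_)⟩
    have hfa : f a = a := (huniv (f a)).resolve_right fun he => hga f hf he.symm
    change f x = x
    rcases huniv x with rfl | rfl
    · exact hfa
    · refine (huniv (f (g a))).resolve_left fun he => hne ?_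
      exact f.injective (hfa.trans he.symm)
  · rw [Nat.card_eq_two_iff]
    exact ⟨a, g a, hne, eq_univ_of_forall fun x => by simpa using huniv x⟩

end Orbit

/-! ### Limits of isometries and closedness -/

section Limits

variable {X : Type*} [MetricSpace X] [ProperSpace X] {G : Subgroup (X ≃ₜ X)} {M : ℝ}

theorem exists_tendsto_of_dist_le {ι : Type*} (U : Ultrafilter ι) {x : ι → X} {c : X} {R : ℝ}
    (h : ∀ᶠ i in (U : Filter ι), dist (x i) c ≤ R) : ∃ y, Tendsto x U (𝓝 y) := by
  obtain ⟨y, -, hy⟩ := (isCompact_closedBall c R).ultrafilter_le_nhds' (U.map x) h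
  exact ⟨y, hy⟩

/-- Isometries are equicontinuous, so pointwise convergence is locally uniform, which is convergence
in the compact-open topology. -/
theorem tendsto_continuousMap_of_isometry {ι : Type*} {l : Filter ι} {F : ι → C(X, X)} {φ : C(X, X)}
    (hF : ∀ᶠ i in l, Isometry (F i)) (hφ : Isometry φ)
    (h : ∀ x, Tendsto (fun i => F i x) l (𝓝 (φ x))) : Tendsto F l (𝓝 φ) := by
  rw [ContinuousMap.tendsto_iff_tendstoLocallyUniformly, Metric.tendstoLocallyUniformly_iff]
  intro ε hε x
  refine ⟨Metric.ball x (ε / 3), Metric.ball_mem_nhds x (by positivity), ?_⟩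
  filter_upwards [hF, Metric.tendsto_nhds.1 (h x) (ε / 3) (by positivity)] with i hi hi' y hy
  have h1 := dist_triangle4 (φ y) (φ x) (F i x) (F i y)
  rw [hφ.dist_eq, hi.dist_eq, dist_comm (φ x), dist_comm x y] at h1
  rw [Metric.mem_ball] at hy
  linarith

/-- Elements of `G` taking `a` to a bounded region have pointwise limits along an ultrafilter, by
properness. The limit is an isometry, and `Iso1` puts it in `G`. -/
theorem isClosed_orbit (hIso1 : Iso1 G) (hG : IsInvariant G (fun x y : X => dist x y)) (a b : X) :
    IsClosed {p : X × X | ∃ f ∈ G, p = (f a, f b)} := by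
  rw [isClosed_iff_ultrafilter]
  rintro ⟨u, v⟩ U hU hmem
  have hch : ∀ p : X × X, ∃ f : X ≃ₜ X, (∃ f ∈ G, p = (f a, f b)) → f ∈ G ∧ p = (f a, f b) := by
    intro p
    by_cases hp : ∃ f ∈ G, p = (f a, f b)
    · exact ⟨hp.choose, fun _ => hp.choose_spec⟩
    · exact ⟨1, fun h => absurd h hp⟩
  choose f hf using hch
  have hev : ∀ᶠ p in (U : Filter (X × X)), f p ∈ G ∧ p = (f p a, f p b) :=
    mem_of_superset hmem fun p hp => hf p hp
  have hfst : Tendsto (fun p => f p a) U (𝓝 u) := by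
    have h1 : Tendsto (Prod.fst : X × X → X) U (𝓝 u) := (continuous_fst.tendsto (u, v)).mono_left hU
    exact h1.congr' (hev.mono fun p hp => congrArg Prod.fst hp.2)
  have hsnd : Tendsto (fun p => f p b) U (𝓝 v) := by
    have h1 : Tendsto (Prod.snd : X × X → X) U (𝓝 v) := (continuous_snd.tendsto (u, v)).mono_left hU
    exact h1.congr' (hev.mono fun p hp => congrArg Prod.snd hp.2)
  have hlim : ∀ x, ∃ y, Tendsto (fun p => f p x) U (𝓝 y) := by
    intro x
    refine exists_tendsto_of_dist_le U (c := u) (R := dist x a + 1) ?_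
    filter_upwards [hev, Metric.tendsto_nhds.1 hfst 1 one_pos] with p hp hp'
    have h1 := dist_triangle (f p x) (f p a) u
    have h2 : dist (f p x) (f p a) = dist x a := hG _ hp.1 x a
    linarith
  choose φ hφ using hlim
  have hφiso : Isometry φ := Isometry.of_dist_eq fun x y => by
    refine tendsto_nhds_unique ((hφ x).dist (hφ y)) ?_
    refine tendsto_const_nhds.congr' (hev.mono fun p hp => ?_)
    exact (hG _ hp.1 x y).symm
  have hconv : Tendsto (fun p => (⟨f p, (f p).continuous⟩ : C(X, X))) U
      (𝓝 ⟨φ, hφiso.continuous⟩) :=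
    tendsto_continuousMap_of_isometry (hev.mono fun p hp => isometry_of_mem hG hp.1) hφiso hφ
  have hin := hIso1.mem_of_tendsto hconv (hev.mono fun p hp => ⟨f p, hp.1, rfl⟩)
  obtain ⟨g, hg, hgφ⟩ := hin
  have hgφ' : ∀ x, g x = φ x := fun x => congrFun hgφ x
  refine ⟨g, hg, ?_⟩
  rw [hgφ', hgφ', tendsto_nhds_unique hfst (hφ a), tendsto_nhds_unique hsnd (hφ b)]

theorem isClosed_pairOrbit (hIso1 : Iso1 G) (hG : IsInvariant G (fun x y : X => dist x y))
    (a b : X) : IsClosed (pairOrbit G a b) := by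
  convert (isClosed_orbit hIso1 hG a b).union (isClosed_orbit hIso1 hG b a) using 1
  ext p
  simp only [pairOrbit, mem_ofPred_eq, mem_union, ← exists_or, ← and_or_left]

/-- The set of metrics that have an isometry taking a pair of points `r`-close to `(a, b)` to a
pair of points `r`-close to `(a', b')`. -/
def transporting (G : Subgroup (X ≃ₜ X)) (M : ℝ) (a b a' b' : X) (r : ℝ) :
    Set (DeltaGM G (fun x y : X => dist x y) M) :=
  {ρ | ∃ g ∈ isometries ρ.1.toFun, ∃ x y,
    dist x a ≤ r ∧ dist y b ≤ r ∧ dist (g x) a' ≤ r ∧ dist (g y) b' ≤ r}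

/-- Along an ultrafilter, the isometries and their inverses are `M`-Lipschitz for `dist` and move a
bounded point to a bounded point, so both converge pointwise. Keeping track of the inverses makes
the limit bijective. -/
theorem isClosed_transporting (hM : 1 < M) (a b a' b' : X) (r : ℝ) :
    IsClosed (transporting G M a b a' b' r) := by
  rw [isClosed_iff_ultrafilter]
  intro ρ U hU hmem
  have hch : ∀ σ : DeltaGM G (fun x y : X => dist x y) M, ∃ (g k : X → X) (x y : X),
      σ ∈ transporting G M a b a' b' r → ((∀ z, g (k z) = z) ∧ (∀ z, k (g z) = z)) ∧
        (∀ z w, σ.1.toFun (g z) (g w) = σ.1.toFun z w) ∧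
        dist x a ≤ r ∧ dist y b ≤ r ∧ dist (g x) a' ≤ r ∧ dist (g y) b' ≤ r := by
    intro σ
    by_cases hσ : σ ∈ transporting G M a b a' b' r
    · obtain ⟨g, ⟨hg, hg'⟩, x, y, h⟩ := hσ
      obtain ⟨k, hk1, hk2⟩ := Function.bijective_iff_has_inverse.1 hg
      exact ⟨g, k, x, y, fun _ => ⟨⟨hk2, hk1⟩, hg', h⟩⟩
    · exact ⟨id, id, a, b, fun h => absurd h hσ⟩
  choose g k xs ys hgk using hch
  have hev := mem_of_superset hmem fun σ hσ => hgk σ hσ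
  change ∀ᶠ σ in U.toFilter, _ at hev
  have hadm : ∀ σ : DeltaGM G (fun x y : X => dist x y) M, IsAdmissible G M σ.1.toFun :=
    isAdmissible_coe
  have hσlim : ∀ x y, Tendsto (fun σ : DeltaGM G (fun x y : X => dist x y) M => σ.1.toFun x y) U
      (𝓝 (ρ.1.toFun x y)) := by
    intro x y
    rw [tendsto_iff_dist_tendsto_zero]
    have h0 : Tendsto (fun σ => dist σ ρ * dist x y) U.toFilter (𝓝 0) := by
      have : Tendsto (fun σ => dist σ ρ) U.toFilter (𝓝 0) :=
        tendsto_iff_dist_tendsto_zero.1 (tendsto_id.mono_left hU)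
      simpa using this.mul_const (dist x y)
    exact squeeze_zero (fun _ => dist_nonneg) (fun σ => abs_sub_le_dist_mul σ ρ x y) h0
  obtain ⟨x, hx⟩ := exists_tendsto_of_dist_le U (hev.mono fun σ hσ => hσ.2.2.1)
  obtain ⟨y, hy⟩ := exists_tendsto_of_dist_le U (hev.mono fun σ hσ => hσ.2.2.2.1)
  have hlip : ∀ σ : DeltaGM G (fun x y : X => dist x y) M, ∀ F : X → X,
      (∀ z w, σ.1.toFun (F z) (F w) = σ.1.toFun z w) → ∀ z w, dist (F z) (F w) ≤ M * dist z w := by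
    intro σ F hF z w
    exact ((hadm σ).dist_le _ _).trans ((hF z w).trans_le ((hadm σ).le_mul z w))
  have hk : ∀ σ, σ ∈ transporting G M a b a' b' r →
      ∀ z w, σ.1.toFun (k σ z) (k σ w) = σ.1.toFun z w := by
    intro σ hσ z w
    have h := (hgk σ hσ).2.1 (k σ z) (k σ w)
    rw [(hgk σ hσ).1.1, (hgk σ hσ).1.1] at h
    exact h.symm
  have hglim : ∀ z, ∃ z', Tendsto (fun σ => g σ z) U (𝓝 z') := by
    intro z
    refine exists_tendsto_of_dist_le U (c := a') (R := M * (dist z a + r) + r) ?_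
    filter_upwards [hev] with σ hσ
    have h1 := dist_triangle (g σ z) (g σ (xs σ)) a'
    have h2 := hlip σ _ hσ.2.1 z (xs σ)
    have h3 := dist_triangle_right z (xs σ) a
    have h4 : M * dist z (xs σ) ≤ M * (dist z a + r) :=
      mul_le_mul_of_nonneg_left (by linarith [hσ.2.2.1]) (by linarith)
    linarith [hσ.2.2.2.2.1]
  have hklim : ∀ z, ∃ z', Tendsto (fun σ => k σ z) U (𝓝 z') := by
    intro z
    refine exists_tendsto_of_dist_le U (c := a) (R := M * (dist z a' + r) + r) ?_
    filter_upwards [hev, hmem] with σ hσ hσ'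
    have h1 := dist_triangle (k σ z) (k σ (g σ (xs σ))) a
    have h2 := hlip σ _ (hk σ hσ') z (g σ (xs σ))
    have h3 := dist_triangle_right z (g σ (xs σ)) a'
    have h4 : M * dist z (g σ (xs σ)) ≤ M * (dist z a' + r) :=
      mul_le_mul_of_nonneg_left (by linarith [hσ.2.2.2.2.1]) (by linarith)
    rw [hσ.1.2] at h1 h2
    linarith [hσ.2.2.1, hσ.1.2 (xs σ)]
  choose γ hγ using hglim
  choose δ hδ using hklim
  -- The common Lipschitz constant allows evaluation at moving points.
  have hcomp : ∀ (F : DeltaGM G (fun x y : X => dist x y) M → X → X) (zs : _ → X) (z w : X),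
      (∀ᶠ σ in U.toFilter, ∀ z w, σ.1.toFun (F σ z) (F σ w) = σ.1.toFun z w) →
      Tendsto zs U (𝓝 z) → Tendsto (fun σ => F σ z) U (𝓝 w) →
      Tendsto (fun σ => F σ (zs σ)) U (𝓝 w) := by
    intro F zs z w hF hz hw
    rw [tendsto_iff_dist_tendsto_zero] at hz hw ⊢
    have h0 : Tendsto (fun σ => M * dist (zs σ) z + dist (F σ z) w) U (𝓝 0) := by
      simpa using (hz.const_mul M).add hw
    refine squeeze_zero' (Eventually.of_forall fun _ => dist_nonneg) (hF.mono fun σ hσ => ?_) h0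
    have h1 := hlip σ _ hσ (zs σ) z
    exact (dist_triangle _ (F σ z) _).trans (by linarith)
  have hFg := hev.mono fun σ hσ => hσ.2.1
  have hFk : ∀ᶠ σ in U.toFilter, ∀ z w, σ.1.toFun (k σ z) (k σ w) = σ.1.toFun z w :=
    mem_of_superset hmem hk
  have hinv1 : ∀ z, γ (δ z) = z := fun z =>
    tendsto_nhds_unique (hcomp g _ _ _ hFg (hδ z) (hγ (δ z)))
      (tendsto_const_nhds.congr' (hev.mono fun σ hσ => (hσ.1.1 z).symm))
  have hinv2 : ∀ z, δ (γ z) = z := fun z =>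
    tendsto_nhds_unique (hcomp k _ _ _ hFk (hγ z) (hδ (γ z)))
      (tendsto_const_nhds.congr' (hev.mono fun σ hσ => (hσ.1.2 z).symm))
  refine ⟨γ, ⟨Function.bijective_iff_has_inverse.2 ⟨δ, hinv2, hinv1⟩, fun z w => ?_⟩, x, y,
    ?_, ?_, ?_, ?_⟩
  · refine tendsto_nhds_unique (IsAdmissible.tendsto (Eventually.of_forall hadm)
      (hσlim (γ z) (γ w)) (hγ z) (hγ w)) ?_
    exact (hσlim z w).congr' (hev.mono fun σ hσ => (hσ.2.1 z w).symm)
  · exact le_of_tendsto (hx.dist tendsto_const_nhds) (hev.mono fun σ hσ => hσ.2.2.1)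
  · exact le_of_tendsto (hy.dist tendsto_const_nhds) (hev.mono fun σ hσ => hσ.2.2.2.1)
  · exact le_of_tendsto ((hcomp g _ _ _ hFg hx (hγ x)).dist tendsto_const_nhds)
      (hev.mono fun σ hσ => hσ.2.2.2.2.1)
  · exact le_of_tendsto ((hcomp g _ _ _ hFg hy (hγ y)).dist tendsto_const_nhds)
      (hev.mono fun σ hσ => hσ.2.2.2.2.2)

end Limits

/-! ### Strict triangle inequality and shortcuts -/

section Perturbation

variable {X : Type*} [MetricSpace X] {G : Subgroup (X ≃ₜ X)} {M : ℝ}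

/-- Every admissible metric is close to one with a quantitative strict triangle inequality. -/
theorem IsAdmissible.exists_strict (hM : 1 < M) (hG : IsInvariant G (fun x y : X => dist x y))
    {ρ : X → X → ℝ} (h : IsAdmissible G M ρ) {ε : ℝ} (hε : 0 < ε) :
    ∃ σ, IsAdmissible G M σ ∧ (∀ x y, |σ x y - ρ x y| ≤ ε * dist x y) ∧
      (∀ x y, x ≠ y → dist x y < σ x y) ∧ ∃ κ > 0, ∀ x y z,
        σ x z + κ * (cap (dist x y) + cap (dist y z) - cap (dist x z)) ≤ σ x y + σ y z := by
  obtain ⟨t, ht0, ht1, htε⟩ : ∃ t : ℝ, 0 < t ∧ t < 1 ∧ t * M ≤ ε := by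
    refine ⟨min (1 / 2) (ε / M), by positivity, by
      linarith [min_le_left (1 / 2 : ℝ) (ε / M)], ?_⟩
    rw [← le_div_iff₀ (by positivity)]
    exact min_le_right _ _
  have hcap : ∀ x y : X, 0 ≤ (M - 1) / 2 * cap (dist x y) ∧
      (M - 1) / 2 * cap (dist x y) ≤ (M - 1) / 2 * dist x y := fun x y =>
    ⟨mul_nonneg (by linarith) (cap_nonneg dist_nonneg),
      mul_le_mul_of_nonneg_left (cap_le_self dist_nonneg) (by linarith)⟩
  -- The coefficient `(1 + M) / 2 > 1` gives room above `dist`, the `cap` term gives strictness, and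
  -- `cap t ≤ t` keeps the sum below `M * dist`. Mixing in `τ` with weight `t` yields `κ = t * ((M -
  -- 1) / 2)`.
  set τ : X → X → ℝ := fun x y => (1 + M) / 2 * dist x y + (M - 1) / 2 * cap (dist x y) with hτ
  have hτ1 : ∀ x y, (1 + M) / 2 * dist x y ≤ τ x y := fun x y => by
    simp only [hτ]; linarith [(hcap x y).1]
  have hτ2 : ∀ x y, τ x y ≤ M * dist x y := fun x y => by
    simp only [hτ]; linarith [(hcap x y).2]
  have hcaptri : ∀ x y z : X, cap (dist x z) ≤ cap (dist x y) + cap (dist y z) := fun x y z => by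
    have h1 := cap_mono dist_nonneg (dist_triangle x y z)
    have h2 := capDefect_nonneg (dist_nonneg (x := x) (y := y)) (dist_nonneg (x := y) (y := z))
    unfold capDefect at h2
    linarith
  have hstrict : ∀ x y z, (1 - t) * ρ x z + t * τ x z + t * ((M - 1) / 2) *
      (cap (dist x y) + cap (dist y z) - cap (dist x z)) ≤
        (1 - t) * ρ x y + t * τ x y + ((1 - t) * ρ y z + t * τ y z) := fun x y z => by
    have h1 := mul_le_mul_of_nonneg_left (h.triangle x y z) (by linarith : 0 ≤ 1 - t)
    have h2 := mul_le_mul_of_nonneg_left (dist_triangle x y z)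
      (by nlinarith : 0 ≤ t * ((1 + M) / 2))
    simp only [hτ]
    linarith
  have hlow : ∀ x y, dist x y + t * ((M - 1) / 2) * dist x y ≤ (1 - t) * ρ x y + t * τ x y :=
    fun x y => by
      have h1 := mul_le_mul_of_nonneg_left (h.dist_le x y) (by linarith : 0 ≤ 1 - t)
      have h2 := mul_le_mul_of_nonneg_left (hτ1 x y) ht0.le
      linarith
  have hκ : 0 < t * ((M - 1) / 2) := mul_pos ht0 (by linarith)
  refine ⟨fun x y => (1 - t) * ρ x y + t * τ x y,
    { eq_zero_iff := fun x y => ⟨fun h0 => ?_, ?_⟩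
      symm := fun x y => by simp only [hτ, h.symm x y, dist_comm x y]
      triangle := fun x y z => ?_
      invariant := fun g hg x y => ?_
      dist_le := fun x y => ?_
      le_mul := fun x y => ?_ }, fun x y => ?_, fun x y hxy => ?_, t * ((M - 1) / 2), hκ, hstrict⟩
  · have h1 := hlow x y
    rw [h0] at h1
    exact dist_le_zero.1 (by linarith [mul_nonneg hκ.le (dist_nonneg (x := x) (y := y))])
  · rintro rfl
    simp [hτ, h.self_eq_zero, cap]
  · have h1 := mul_nonneg hκ.le (sub_nonneg.2 (hcaptri x y z))
    linarith [hstrict x y z]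
  · have h1 : dist (g x) (g y) = dist x y := hG g hg x y
    simp only [hτ, h1, h.invariant g hg x y]
  · linarith [hlow x y, mul_nonneg hκ.le (dist_nonneg (x := x) (y := y))]
  · have h1 := mul_le_mul_of_nonneg_left (h.le_mul x y) (by linarith : 0 ≤ 1 - t)
    have h2 := mul_le_mul_of_nonneg_left (hτ2 x y) ht0.le
    linarith
  · have h1 : |τ x y - ρ x y| ≤ M * dist x y := by
      have h2 := hτ1 x y
      have h3 : 0 ≤ (1 + M) / 2 * dist x y := mul_nonneg (by linarith) dist_nonneg
      rw [abs_le]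
      constructor <;> linarith [h.nonneg x y, h.le_mul x y, hτ2 x y]
    have h2 : (1 - t) * ρ x y + t * τ x y - ρ x y = t * (τ x y - ρ x y) := by ring
    rw [h2, abs_mul, abs_of_pos ht0]
    calc t * |τ x y - ρ x y| ≤ t * (M * dist x y) := by gcongr
      _ = t * M * dist x y := by ring
      _ ≤ ε * dist x y := by gcongr
  · linarith [hlow x y, mul_pos hκ (dist_pos.2 hxy)]

/-- In a proper space only a compact part of `S` competes for the minimum. -/
theorem IsAdmissible.exists_nearest [ProperSpace X] {ρ : X → X → ℝ} (h : IsAdmissible G M ρ)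
    {S : Set (X × X)} (hS : IsClosed S) (hne : S.Nonempty) (x y : X) :
    ∃ p ∈ S, ∀ u v, (u, v) ∈ S → ρ x p.1 + ρ p.2 y ≤ ρ x u + ρ v y := by
  obtain ⟨p₀, hp₀⟩ := hne
  set R := ρ x p₀.1 + ρ p₀.2 y
  have hball : ∀ p : X × X, ρ x p.1 + ρ p.2 y ≤ R → p ∈ Metric.closedBall (x, y) R := by
    intro p hp
    rw [Metric.mem_closedBall, Prod.dist_eq, max_le_iff]
    have h1 := h.dist_le x p.1
    have h2 := h.dist_le p.2 y
    rw [dist_comm] at h1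
    exact ⟨by linarith [h.nonneg p.2 y], by linarith [h.nonneg x p.1]⟩
  have hcont : Continuous fun p : X × X => ρ x p.1 + ρ p.2 y :=
    (h.continuous.comp (continuous_const.prodMk continuous_fst)).add
      (h.continuous.comp (continuous_snd.prodMk continuous_const))
  obtain ⟨p, hp, hmin⟩ := ((isCompact_closedBall (x, y) R).inter_left hS).exists_isMinOn
    ⟨p₀, hp₀, hball p₀ le_rfl⟩ hcont.continuousOn
  refine ⟨p, hp.1, fun u v huv => ?_⟩
  by_cases hR : ρ x u + ρ v y ≤ R
  · exact hmin ⟨huv, hball (u, v) hR⟩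
  · exact (hmin ⟨hp₀, hball p₀ le_rfl⟩).trans (not_le.1 hR).le

/-- Shortening slightly all pairs in the orbit of `(a, b)`. -/
theorem IsAdmissible.exists_shortcut [ProperSpace X] (hM : 1 < M) {ρ : X → X → ℝ}
    (h : IsAdmissible G M ρ) (hlt : ∀ x y, x ≠ y → dist x y < ρ x y) {κ : ℝ} (hκ : 0 < κ)
    (hstrict : ∀ x y z,
      ρ x z + κ * (cap (dist x y) + cap (dist y z) - cap (dist x z)) ≤ ρ x y + ρ y z)
    (hG : IsInvariant G (fun x y : X => dist x y)) {a b : X} (hab : a ≠ b)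
    (hS : IsClosed (pairOrbit G a b)) {s ε : ℝ} (hs : 0 < s) (hε : 0 < ε) (w : ℝ) :
    ∃ σ, IsAdmissible G M σ ∧ (∀ x y, |σ x y - ρ x y| ≤ ε * dist x y) ∧ σ a b ≠ w ∧
      (∀ x y, (∀ u v, (u, v) ∈ pairOrbit G a b → s ≤ dist x u + dist v y) →
        σ x y = ρ x y ∧ ∀ c, c ≠ x → c ≠ y → σ x y < σ x c + σ c y) ∧
      ∃ r > 0, ∀ x y, dist x a < r → dist y b < r → (x, y) ∉ pairOrbit G a b →
        ∃ c, c ≠ x ∧ c ≠ y ∧ σ x y = σ x c + σ c y := by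
  have hl : 0 < dist a b := dist_pos.2 hab
  set l := dist a b with hldef
  set L := ρ a b with hLdef
  have hlL : l < L := hlt a b hab
  have hL : 0 < L := hl.trans hlL
  have hD1 : 0 < κ * capDefect l l := mul_pos hκ (capDefect_pos hl hl)
  have hD2 : 0 < κ * capDefect s l := mul_pos hκ (capDefect_pos hs hl)
  -- In order, `η` is small enough for the shortened length to stay above `L / 2` and above `l`, for
  -- the change to be at most `ε * dist`, for two consecutive shortcuts not to pay, and for pairs at
  -- distance `s` from the orbit to be unaffected; finally it avoids the value `w`.
  obtain ⟨η, hη, hη1, hη2, hη3, hη4, hη5, hηw⟩ : ∃ η : ℝ, 0 < η ∧ η < L / 2 ∧ η < L - l ∧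
      η < ε * (L / (2 * M)) ∧ η < κ * capDefect l l / 2 ∧ η < κ * capDefect s l ∧ L - η ≠ w := by
    have hsmall : ∀ᶠ η in 𝓝[>] (0 : ℝ), 0 < η ∧ η < L / 2 ∧ η < L - l ∧
        η < ε * (L / (2 * M)) ∧ η < κ * capDefect l l / 2 ∧ η < κ * capDefect s l := by
      have hM0 : 0 < M := by linarith
      refine eventually_mem_nhdsWithin.and (Eventually.filter_mono nhdsWithin_le_nhds ?_)
      refine (eventually_lt_nhds ?_).and ((eventually_lt_nhds ?_).and
        ((eventually_lt_nhds ?_).and ((eventually_lt_nhds ?_).and (eventually_lt_nhds ?_))))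
      all_goals first | assumption | positivity
    have hne : ∀ᶠ η in 𝓝[>] (0 : ℝ), L - η ≠ w := by
      by_cases hw : L - w = 0
      · filter_upwards [self_mem_nhdsWithin] with η hη he
        rw [mem_Ioi] at hη
        linarith
      · refine Eventually.filter_mono nhdsWithin_le_nhds ?_
        filter_upwards [eventually_ne_nhds (Ne.symm hw)] with η hη he
        exact hη (by linarith)
    obtain ⟨η, hη, hw⟩ := (hsmall.and hne).exists
    exact ⟨η, hη.1, hη.2.1, hη.2.2.1, hη.2.2.2.1, hη.2.2.2.2.1, hη.2.2.2.2.2, hw⟩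
  have hSL : ∀ u v, (u, v) ∈ pairOrbit G a b → ρ u v = L := fun u v huv =>
    eq_of_mem_pairOrbit h.invariant h.symm huv
  have hSl : ∀ u v, (u, v) ∈ pairOrbit G a b → dist u v = l := fun u v huv =>
    eq_of_mem_pairOrbit hG dist_comm huv
  choose P hPS hPmin using h.exists_nearest hS ⟨(a, b), mem_pairOrbit_self a b⟩
  -- The distance from `(x, y)` to the orbit, as a sum over both coordinates; the new metric is the
  -- minimum of `ρ` and `L - η + e`.
  set e : X → X → ℝ := fun x y => ρ x (P x y).1 + ρ (P x y).2 y with he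
  have hele : ∀ x y u v, (u, v) ∈ pairOrbit G a b → e x y ≤ ρ x u + ρ v y := hPmin
  have heeq : ∀ x y, ∃ u v, (u, v) ∈ pairOrbit G a b ∧ e x y = ρ x u + ρ v y := fun x y =>
    ⟨(P x y).1, (P x y).2, hPS x y, rfl⟩
  clear_value e
  clear he hPmin hPS P
  have he0 : ∀ x y, 0 ≤ e x y := fun x y => by
    obtain ⟨u, v, -, h1⟩ := heeq x y
    linarith [h.nonneg x u, h.nonneg v y]
  have hesymm_le : ∀ x y, e x y ≤ e y x := fun x y => by
    obtain ⟨u, v, huv, h1⟩ := heeq y x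
    have h2 := hele x y v u (pairOrbit_swap huv)
    rw [h1, h.symm y u, h.symm v x]
    linarith
  have hesymm : ∀ x y, e x y = e y x := fun x y => le_antisymm (hesymm_le x y) (hesymm_le y x)
  have hetri : ∀ x y z, e x z ≤ e x y + ρ y z := fun x y z => by
    obtain ⟨u, v, huv, h1⟩ := heeq x y
    linarith [hele x z u v huv, h.triangle v y z]
  have heinv_le : ∀ g ∈ G, ∀ x y, e (g x) (g y) ≤ e x y := fun g hg x y => by
    obtain ⟨u, v, huv, h1⟩ := heeq x y
    have h2 := hele (g x) (g y) _ _ (pairOrbit_smul huv hg)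
    rwa [h.invariant g hg, h.invariant g hg, ← h1] at h2
  have heinv : ∀ g ∈ G, ∀ x y, e (g x) (g y) = e x y := fun g hg x y => by
    refine le_antisymm (heinv_le g hg x y) ?_
    have h1 := heinv_le g⁻¹ (G.inv_mem hg) (g x) (g y)
    change e (g.symm (g x)) (g.symm (g y)) ≤ _ at h1
    rwa [g.symm_apply_apply, g.symm_apply_apply] at h1
  have hρe : ∀ x y, ρ x y ≤ e x y + L := fun x y => by
    obtain ⟨u, v, huv, h1⟩ := heeq x y
    linarith [h.triangle x u y, h.triangle u v y, hSL u v huv]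
  -- Two strict triangle inequalities along `u, v, u', v'` gain at least `κ * capDefect l l > 2 *
  -- η`, more than two shortcuts save.
  have htwo : ∀ x y z, ρ x z < (L - η + e x y) + (L - η + e y z) := fun x y z => by
    obtain ⟨u, v, huv, h1⟩ := heeq x y
    obtain ⟨u', v', huv', h2⟩ := heeq y z
    have h3 := hstrict u v v'
    have h4 := hstrict v u' v'
    rw [hSL u v huv, hSl u v huv] at h3
    rw [hSL u' v' huv', hSl u' v' huv'] at h4
    have h5 : dist u v' ≤ (l + l) + dist v u' := by
      linarith [dist_triangle4 u v u' v', hSl u v huv, hSl u' v' huv']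
    have h6 := cap_mono dist_nonneg h5
    have h7 := capDefect_nonneg (add_nonneg hl.le hl.le) (dist_nonneg (x := v) (y := u'))
    have h8 : κ * capDefect l l ≤ κ * (cap l + cap l + cap (dist v u') - cap (dist u v')) := by
      refine mul_le_mul_of_nonneg_left ?_ hκ.le
      unfold capDefect at h7 ⊢
      linarith
    linarith [h.triangle x u z, h.triangle u v' z, h.triangle v y u']
  have hfar : ∀ x y, (∀ u v, (u, v) ∈ pairOrbit G a b → s ≤ dist x u + dist v y) →
      ρ x y < L - η + e x y := fun x y hxy => by
    obtain ⟨u, v, huv, h1⟩ := heeq x y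
    have h2 := hxy u v huv
    have h3 := hstrict x u y
    have h4 := hstrict u v y
    rw [hSL u v huv, hSl u v huv] at h4
    have h5 : dist x y ≤ (dist x u + dist v y) + l := by
      linarith [dist_triangle4 x u v y, hSl u v huv]
    have h6 := cap_mono dist_nonneg h5
    have h7 := capDefect_nonneg (dist_nonneg (x := x) (y := u)) (dist_nonneg (x := v) (y := y))
    have h8 := capDefect_mono_left hs.le h2 hl.le
    have h9 : κ * capDefect s l ≤
        κ * (cap (dist x u) + cap l + cap (dist v y) - cap (dist x y)) := by
      refine mul_le_mul_of_nonneg_left (h8.trans ?_) hκ.le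
      unfold capDefect at h7 ⊢
      linarith
    linarith
  have hmet : IsMetric fun x y => min (ρ x y) (L - η + e x y) := by
    refine h.toIsMetric.min_shortcut (fun x y => by linarith [he0 x y])
      (fun x y => by rw [hesymm]) (fun x y z => by linarith [hetri x y z]) fun x y z => ?_
    exact (htwo x y z).le
  have hcap : ∀ x y, min (ρ x y) (L - η + e x y) ≤ ρ x y := fun x y => min_le_left _ _
  have hSσ : ∀ u v, (u, v) ∈ pairOrbit G a b → min (ρ u v) (L - η + e u v) ≤ L - η := by
    intro u v huv
    have h1 := hele u v u v huv
    rw [h.self_eq_zero, h.self_eq_zero] at h1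
    exact (min_le_right _ _).trans (by linarith)
  refine ⟨_, { toIsMetric := hmet
               invariant := fun g hg x y => by simp only [h.invariant g hg, heinv g hg]
               dist_le := fun x y => ?_
               le_mul := fun x y => (hcap x y).trans (h.le_mul x y) },
    fun x y => ?_, ?_, fun x y hxy => ⟨min_eq_left (hfar x y hxy).le, fun c hcx hcy => ?_⟩,
    -- Within this radius `e < η / 2` and `ρ x y > L - η / 2`, so the shortcut is the shorter way.
    η / (4 * M), div_pos hη (by linarith), fun x y hx hy hxy => ?_⟩
  · obtain ⟨u, v, huv, h1⟩ := heeq x y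
    refine le_min (h.dist_le x y) ?_
    linarith [dist_triangle4 x u v y, hSl u v huv, h.dist_le x u, h.dist_le v y]
  · rcases min_choice (ρ x y) (L - η + e x y) with h1 | h1
    · rw [h1, sub_self, abs_zero]
      exact mul_nonneg hε.le dist_nonneg
    · have h2 := hcap x y
      rw [h1] at h2 ⊢
      rw [abs_sub_comm, abs_of_nonneg (sub_nonneg.2 h2)]
      have h3 : L / (2 * M) ≤ dist x y := by
        rw [div_le_iff₀ (by linarith)]
        linarith [h.le_mul x y, he0 x y]
      have h4 := mul_le_mul_of_nonneg_left h3 hε.le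
      linarith [hρe x y]
  · have h1 := hele a b a b (mem_pairOrbit_self a b)
    rw [h.self_eq_zero, h.self_eq_zero] at h1
    have h2 : e a b = 0 := le_antisymm (by linarith) (he0 a b)
    change min (ρ a b) (L - η + e a b) ≠ w
    rw [h2, add_zero, min_eq_right (by linarith)]
    exact hηw
  · have h0 := hfar x y hxy
    change min (ρ x y) (L - η + e x y) < min (ρ x c) (L - η + e x c) + min (ρ c y) (L - η + e c y)
    rw [min_eq_left h0.le]
    rcases min_choice (ρ x c) (L - η + e x c) with h1 | h1 <;>
      rcases min_choice (ρ c y) (L - η + e c y) with h2 | h2 <;> rw [h1, h2]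
    · have h3 := hstrict x c y
      have h4 := capDefect_pos (dist_pos.2 (Ne.symm hcx)) (dist_pos.2 hcy)
      have h5 := cap_mono dist_nonneg (dist_triangle x c y)
      have h6 : 0 < κ * (cap (dist x c) + cap (dist c y) - cap (dist x y)) := by
        refine mul_pos hκ ?_
        unfold capDefect at h4
        linarith
      linarith
    · have h3 := hetri y c x
      rw [hesymm y x, hesymm y c, h.symm c x] at h3
      linarith
    · linarith [hetri x c y]
    · exact htwo x c y
  · have hM0 : 0 < M := by linarith
    rw [lt_div_iff₀ (by positivity)] at hx hy
    have h1 := (abs_le.1 (h.abs_sub_le x y a b)).1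
    have h2 := hele x y a b (mem_pairOrbit_self a b)
    have h3 := h.le_mul x a
    have h4 := h.le_mul b y
    rw [dist_comm] at h4
    have h5 : L - η + e x y ≤ ρ x y := by linarith
    have h6 : min (ρ x y) (L - η + e x y) = L - η + e x y := min_eq_right h5
    obtain ⟨u, v, huv, h7⟩ := heeq x y
    -- Off the orbit, the nearest pair `(u, v)` differs from `(x, y)` in some coordinate, and that
    -- coordinate lies between `x` and `y`.
    by_cases hxu : u = x
    · subst hxu
      have hvy : v ≠ y := fun hvy => hxy (hvy ▸ huv)
      refine ⟨v, fun hvu => ?_, hvy, le_antisymm (hmet.triangle u v y) ?_⟩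
      · have h8 := hSL u v huv
        rw [hvu, h.self_eq_zero] at h8
        linarith
      · simp only [h6]
        have h8 := hSσ u v huv
        rw [h.self_eq_zero] at h7
        linarith [hcap v y]
    · refine ⟨u, hxu, fun huy => ?_, le_antisymm (hmet.triangle x u y) ?_⟩
      · rw [huy] at h7
        linarith [h.nonneg v y]
      · have h8 := hSσ u v huv
        have h9 := hmet.triangle u v y
        simp only [h6]
        linarith [hcap v y, hcap x u]

theorem transporting_comm (a b a' b' : X) (r : ℝ) :
    transporting G M a b a' b' r = transporting G M a' b' a b r := by
  suffices h : ∀ a b a' b' : X, transporting G M a b a' b' r ⊆ transporting G M a' b' a b r from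
    (h _ _ _ _).antisymm (h _ _ _ _)
  rintro a b a' b' ρ ⟨g, ⟨hg, hg'⟩, x, y, hx, hy, hx', hy'⟩
  obtain ⟨k, hk1, hk2⟩ := Function.bijective_iff_has_inverse.1 hg
  refine ⟨k, ⟨Function.bijective_iff_has_inverse.2 ⟨g, hk2, hk1⟩, fun z w => ?_⟩, g x, g y,
    hx', hy', ?_, ?_⟩
  · rw [← hg', hk2, hk2]
  · rwa [hk1]
  · rwa [hk1]

end Perturbation

/-! ### Density of the complements and the category argument -/

section Density

variable {X : Type*} [MetricSpace X] [ProperSpace X] {G : Subgroup (X ≃ₜ X)} {M : ℝ}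

theorem exists_perturbation (hM : 1 < M) (hIso1 : Iso1 G)
    (hG : IsInvariant G (fun x y : X => dist x y)) {a b a' b' : X} (hab : a ≠ b) {s ε : ℝ}
    (hs : 0 < s) (hε : 0 < ε) (ρ : DeltaGM G (fun x y : X => dist x y) M)
    (hq : ∀ u v, (u, v) ∈ pairOrbit G a b → s ≤ dist a' u + dist v b') :
    ∃ σ : DeltaGM G (fun x y : X => dist x y) M, dist σ ρ < ε ∧
      σ.1.toFun a b ≠ σ.1.toFun a' b' ∧
      (∀ x y, (∀ u v, (u, v) ∈ pairOrbit G a b → s ≤ dist x u + dist v y) →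
        ∀ c, c ≠ x → c ≠ y → σ.1.toFun x y < σ.1.toFun x c + σ.1.toFun c y) ∧
      ∃ r > 0, ∀ x y, dist x a < r → dist y b < r → (x, y) ∉ pairOrbit G a b →
        ∃ c, c ≠ x ∧ c ≠ y ∧ σ.1.toFun x y = σ.1.toFun x c + σ.1.toFun c y := by
  obtain ⟨τ, hτ, hτρ, hlt, κ, hκ, hstrict⟩ :=
    (isAdmissible_coe ρ).exists_strict hM hG (ε := ε / 4) (by positivity)
  obtain ⟨σ, hσ, hστ, hne, hfar, hnear⟩ := hτ.exists_shortcut hM hlt hκ hstrict hG hab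
    (isClosed_pairOrbit hIso1 hG a b) hs (ε := ε / 4) (by positivity) (τ a' b')
  refine ⟨hσ.toDelta hM, ?_, ?_, fun x y hxy => (hfar x y hxy).2, hnear⟩
  · refine (dist_le_of_abs_sub_le (C := ε / 2) (by positivity) fun x y => ?_).trans_lt (by linarith)
    have h1 := _root_.abs_sub_le (σ x y) (τ x y) (ρ.1.toFun x y)
    change |σ x y - ρ.1.toFun x y| ≤ _
    linarith [hτρ x y, hστ x y]
  · change σ a b ≠ σ a' b'
    rwa [(hfar a' b' hq).1]

/-- After the perturbation, a pair off the orbit and very close to `(a, b)` has a point between. An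
isometry would carry it to a pair near `(a', b')`, far from the orbit, which has none. -/
theorem dense_compl_transporting_of_accumulating (hM : 1 < M) (hIso1 : Iso1 G)
    (hG : IsInvariant G (fun x y : X => dist x y)) {a b a' b' : X} (hab : a ≠ b) {r : ℝ}
    (hr : 0 < r)
    (hq : ∀ u v, (u, v) ∈ pairOrbit G a b → 4 * (2 * M + 1) * r ≤ dist a' u + dist v b')
    (hacc : ∀ δ > 0, ∃ x y, dist x a < δ ∧ dist y b < δ ∧ (x, y) ∉ pairOrbit G a b) :
    Dense (transporting G M a b a' b' r)ᶜ := by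
  refine Metric.dense_iff.2 fun ρ ε hε => ?_
  have hMr : 0 < (2 * M + 1) * r := mul_pos (by linarith) hr
  obtain ⟨σ, hσρ, -, hfar, δ, hδ, hnear⟩ := exists_perturbation hM hIso1 hG hab
    -- Each image point lies within `(2 * M + 1) * r` of `a'` or `b'`, which uses up half of the
    -- distance in `hq`.
    (s := 2 * (2 * M + 1) * r) (by linarith) hε ρ (fun u v huv => (by linarith [hq u v huv]))
  refine ⟨σ, hσρ, ?_⟩
  rintro ⟨g, ⟨hg, hg'⟩, x, y, hx, hy, hx', hy'⟩
  obtain ⟨x₁, y₁, hx₁, hy₁, hxy₁⟩ := hacc (min δ r) (lt_min hδ hr)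
  obtain ⟨c, hcx, hcy, hc⟩ := hnear x₁ y₁ (hx₁.trans_le (min_le_left _ _))
    (hy₁.trans_le (min_le_left _ _)) hxy₁
  have hclose : ∀ z z₁ w w', dist z w ≤ r → dist z₁ w < min δ r → dist (g z) w' ≤ r →
      dist (g z₁) w' ≤ (2 * M + 1) * r := by
    intro z z₁ w w' h1 h2 h3
    have h4 := (isAdmissible_coe σ).dist_le (g z₁) (g z)
    rw [hg'] at h4
    have h5 := (isAdmissible_coe σ).le_mul z₁ z
    have h6 := dist_triangle_right z₁ z w
    have h7 : M * dist z₁ z ≤ M * (2 * r) :=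
      mul_le_mul_of_nonneg_left (by linarith [min_le_right δ r]) (by linarith)
    linarith [dist_triangle (g z₁) (g z) w']
  have h1 := hclose x x₁ a a' hx hx₁ hx'
  have h2 := hclose y y₁ b b' hy hy₁ hy'
  have h3 := hfar (g x₁) (g y₁) (fun u v huv => by
    have h4 := hq u v huv
    have h5 := dist_triangle_left a' u (g x₁)
    have h6 := dist_triangle v (g y₁) b'
    linarith) (g c) (hg.1.ne hcx) (hg.1.ne hcy)
  rw [hg', hg', hg'] at h3
  linarith

/-- All pairs near `(a, b)` have one length, as do all pairs near `(a', b')`; the perturbation makes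
these lengths differ. -/
theorem dense_compl_transporting_of_isolated (hM : 1 < M) (hIso1 : Iso1 G)
    (hG : IsInvariant G (fun x y : X => dist x y)) {a b a' b' : X} (hab : a ≠ b) {r s : ℝ}
    (hs : 0 < s) (hq : ∀ u v, (u, v) ∈ pairOrbit G a b → s ≤ dist a' u + dist v b')
    (h : ∀ x y, dist x a ≤ r → dist y b ≤ r → (x, y) ∈ pairOrbit G a b)
    (h' : ∀ x y, dist x a' ≤ r → dist y b' ≤ r → (x, y) ∈ pairOrbit G a' b') :
    Dense (transporting G M a b a' b' r)ᶜ := by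
  refine Metric.dense_iff.2 fun ρ ε hε => ?_
  obtain ⟨σ, hσρ, hne, -⟩ := exists_perturbation hM hIso1 hG hab hs hε ρ hq
  refine ⟨σ, hσρ, ?_⟩
  rintro ⟨g, ⟨-, hg⟩, x, y, hx, hy, hx', hy'⟩
  have hσ := isAdmissible_coe σ
  refine hne ?_
  rw [← eq_of_mem_pairOrbit hσ.invariant hσ.symm (h x y hx hy),
    ← eq_of_mem_pairOrbit hσ.invariant hσ.symm (h' _ _ hx' hy'), hg]

theorem exists_pos_le_of_notMem_pairOrbit (hIso1 : Iso1 G)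
    (hG : IsInvariant G (fun x y : X => dist x y)) {a b a' b' : X}
    (h : (a', b') ∉ pairOrbit G a b) :
    ∃ s > 0, ∀ u v, (u, v) ∈ pairOrbit G a b → s ≤ dist a' u + dist v b' := by
  obtain ⟨s, hs, hball⟩ := Metric.isOpen_iff.1 (isClosed_pairOrbit hIso1 hG a b).isOpen_compl _ h
  refine ⟨s, hs, fun u v huv => ?_⟩
  by_contra! hlt
  refine hball (a := (u, v)) ?_ huv
  rw [Metric.mem_ball, Prod.dist_eq, max_lt_iff]
  change dist u a' < s ∧ dist v b' < s
  rw [dist_comm u]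
  exact ⟨by linarith [dist_nonneg (x := v) (y := b')], by linarith [dist_nonneg (x := a') (y := u)]⟩

theorem exists_dense_compl_transporting (hM : 1 < M) (hIso1 : Iso1 G)
    (hG : IsInvariant G (fun x y : X => dist x y)) {a b a' b' : X} (hab : a ≠ b) (hab' : a' ≠ b')
    (hne : (a', b') ∉ pairOrbit G a b) :
    ∃ r > 0, (∀ x y x' y', dist x a ≤ r → dist y b ≤ r → dist x' a' ≤ r → dist y' b' ≤ r →
      (x', y') ∉ pairOrbit G x y) ∧ Dense (transporting G M a b a' b' r)ᶜ := by
  obtain ⟨s, hs, hq⟩ := exists_pos_le_of_notMem_pairOrbit hIso1 hG hne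
  obtain ⟨s', hs', hp⟩ := exists_pos_le_of_notMem_pairOrbit hIso1 hG
    (fun h => hne (pairOrbit_symm h))
  -- Each of the four points is displaced by at most `r`.
  have hsep : ∀ r, 4 * r < s → ∀ x y x' y', dist x a ≤ r → dist y b ≤ r → dist x' a' ≤ r →
      dist y' b' ≤ r → (x', y') ∉ pairOrbit G x y := by
    rintro r hr x y x' y' hx hy hx' hy' ⟨f, hf, h | h⟩ <;> rw [Prod.mk.injEq] at h <;>
      obtain ⟨rfl, rfl⟩ := h
    · have h1 := hq (f a) (f b) ⟨f, hf, Or.inl rfl⟩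
      have h2 := (isometry_of_mem hG hf).dist_eq x a
      have h3 := (isometry_of_mem hG hf).dist_eq y b
      have h4 := dist_triangle_left a' (f a) (f x)
      have h5 := dist_triangle_left (f b) b' (f y)
      linarith
    · have h1 := hq (f b) (f a) ⟨f, hf, Or.inr rfl⟩
      have h2 := (isometry_of_mem hG hf).dist_eq x a
      have h3 := (isometry_of_mem hG hf).dist_eq y b
      have h4 := dist_triangle_left a' (f b) (f y)
      have h5 := dist_triangle_left (f a) b' (f x)
      linarith
  have hM0 : 0 < 4 * (2 * M + 1) := by linarith
  by_cases hacc : ∀ δ > 0, ∃ x y, dist x a < δ ∧ dist y b < δ ∧ (x, y) ∉ pairOrbit G a b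
  · refine ⟨s / (4 * (2 * M + 1)), by positivity, hsep _ ?_,
      dense_compl_transporting_of_accumulating hM hIso1 hG hab (by positivity)
        (fun u v huv => ?_) hacc⟩
    · rw [← mul_div_assoc, div_lt_iff₀ hM0]
      nlinarith
    · rw [mul_div_cancel₀ _ hM0.ne']
      exact hq u v huv
  by_cases hacc' : ∀ δ > 0, ∃ x y, dist x a' < δ ∧ dist y b' < δ ∧ (x, y) ∉ pairOrbit G a' b'
  · refine ⟨min s s' / (4 * (2 * M + 1)), by positivity, hsep _ ?_, ?_⟩
    · rw [← mul_div_assoc, div_lt_iff₀ hM0]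
      nlinarith [min_le_left s s']
    · rw [transporting_comm]
      refine dense_compl_transporting_of_accumulating hM hIso1 hG hab' (by positivity)
        (fun u v huv => ?_) hacc'
      rw [mul_div_cancel₀ _ hM0.ne']
      exact (min_le_right _ _).trans (hp u v huv)
  push Not at hacc hacc'
  obtain ⟨δ, hδ, h⟩ := hacc
  obtain ⟨δ', hδ', h'⟩ := hacc'
  have h1 := min_le_left (min δ δ') s
  have h2 := min_le_right (min δ δ') s
  have h3 := min_le_left δ δ'
  have h4 := min_le_right δ δ'
  have h5 : 0 < min (min δ δ') s := by positivity
  refine ⟨min (min δ δ') s / 5, by positivity, hsep _ (by linarith),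
    dense_compl_transporting_of_isolated hM hIso1 hG hab hs hq
      (fun x y hx hy => h x y (by linarith) (by linarith))
      (fun x y hx hy => h' x y (by linarith) (by linarith))⟩

theorem dense_and_isGδ_of_metricSpace [Nonempty X] (hcard : ¬ (Nat.card G = 1 ∧ Nat.card X = 2))
    (hM : 1 < M) (hIso1 : Iso1 G) (hG : IsInvariant G (fun x y : X => dist x y)) :
    Dense {ρ : DeltaGM G (fun x y : X => dist x y) M |
      isometries ρ.1.toFun = symmetrizedTwoHull (mapsOf G)} ∧
    IsGδ {ρ : DeltaGM G (fun x y : X => dist x y) M |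
      isometries ρ.1.toFun = symmetrizedTwoHull (mapsOf G)} := by
  have := completeSpace_deltaGM (G := G) (X := X) hM
  -- Only pairs of distinct points occur, since only these can be shortened.
  set Ω : Set ((X × X) × (X × X)) :=
    {q | q.1.1 ≠ q.1.2 ∧ q.2.1 ≠ q.2.2 ∧ q.2 ∉ pairOrbit G q.1.1 q.1.2} with hΩ
  have hrad : ∀ q : Ω, ∃ r > 0, (∀ x y x' y', dist x q.1.1.1 ≤ r → dist y q.1.1.2 ≤ r →
      dist x' q.1.2.1 ≤ r → dist y' q.1.2.2 ≤ r → (x', y') ∉ pairOrbit G x y) ∧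
      Dense (transporting G M q.1.1.1 q.1.1.2 q.1.2.1 q.1.2.2 r)ᶜ := fun q =>
    exists_dense_compl_transporting hM hIso1 hG q.2.1 q.2.2.1 q.2.2.2
  choose r hr hsep hdense using hrad
  obtain ⟨T, hT, hcover⟩ := TopologicalSpace.isOpen_iUnion_countable
    (fun q : Ω => Metric.ball q.1 (r q)) fun q => Metric.isOpen_ball
  have hset : {ρ : DeltaGM G (fun x y : X => dist x y) M |
      isometries ρ.1.toFun = symmetrizedTwoHull (mapsOf G)} =
      ⋂ q : T, (transporting G M q.1.1.1.1 q.1.1.1.2 q.1.1.2.1 q.1.1.2.2 (r q.1))ᶜ := by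
    ext ρ
    have hρ := isAdmissible_coe ρ
    rw [mem_iInter]
    constructor
    · rintro hiso ⟨q, _⟩ ⟨g, hg, x, y, hx, hy, hx', hy'⟩
      rw [mem_ofPred_eq] at hiso
      rw [hiso, mem_symmetrizedTwoHull_iff] at hg
      exact hsep q x y _ _ hx hy hx' hy' (hg x y)
    · intro hmem
      refine (symmetrizedTwoHull_subset_isometries hG hρ.toIsMetric hρ.invariant).antisymm' ?_
      intro g hg
      refine mem_symmetrizedTwoHull_of_ne hcard fun x y hxy => ?_
      by_contra hcon
      have hin : ((x, y), (g x, g y)) ∈ ⋃ q ∈ T, Metric.ball q.1 (r q) := by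
        rw [hcover]
        exact mem_iUnion.2 ⟨⟨_, hxy, hg.1.1.ne hxy, hcon⟩, Metric.mem_ball_self (hr _)⟩
      obtain ⟨q, hqT, hq⟩ := mem_iUnion₂.1 hin
      simp only [Metric.mem_ball, Prod.dist_eq, max_lt_iff] at hq
      exact hmem ⟨q, hqT⟩ ⟨g, hg, x, y, hq.1.1.le, hq.1.2.le, hq.2.1.le, hq.2.2.le⟩
  have := hT.to_subtype
  have hopen : ∀ q : T, IsOpen
      (transporting G M q.1.1.1.1 q.1.1.1.2 q.1.1.2.1 q.1.1.2.2 (r q.1))ᶜ := fun q =>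
    (isClosed_transporting hM _ _ _ _ _).isOpen_compl
  rw [hset]
  exact ⟨dense_iInter_of_isOpen hopen fun q => hdense q.1, IsGδ.iInter_of_isOpen hopen⟩

end Density

/-! ### From a compatible metric to a metric space -/

section Topology

variable {X : Type*} [t : TopologicalSpace X]

/-- The metric space structure given by a proper compatible metric. -/
abbrev IsProperCompatibleMetric.metricSpace {d : X → X → ℝ} (hd : IsProperCompatibleMetric d) :
    MetricSpace X :=
  -- The given topology is kept definitionally, so that `G` and `Iso1` retain their meaning.
  MetricSpace.replaceTopology
    { dist := d
      dist_self := hd.toIsMetric.self_eq_zero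
      dist_comm := hd.symm
      dist_triangle := hd.triangle
      eq_of_dist_eq_zero := fun {x y} h => (hd.eq_zero_iff x y).1 h }
    (by
      let m : MetricSpace X :=
        { dist := d
          dist_self := hd.toIsMetric.self_eq_zero
          dist_comm := hd.symm
          dist_triangle := hd.triangle
          eq_of_dist_eq_zero := fun {x y} h => (hd.eq_zero_iff x y).1 h }
      refine TopologicalSpace.ext_iff.2 fun s => ?_
      rw [hd.isOpen_iff, @Metric.isOpen_iff X m.toPseudoMetricSpace]
      refine forall₂_congr fun x _ => exists_congr fun ε => and_congr_right fun _ => ?_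
      have : {y | d x y < ε} = @Metric.ball X m.toPseudoMetricSpace x ε := by
        ext y
        rw [@Metric.mem_ball' X m.toPseudoMetricSpace]
        rfl
      rw [this])

theorem IsProperCompatibleMetric.properSpace {d : X → X → ℝ} (hd : IsProperCompatibleMetric d) :
    @ProperSpace X hd.metricSpace.toPseudoMetricSpace := by
  let m := hd.metricSpace
  refine ⟨fun x r => ?_⟩
  have : Metric.closedBall x r = {y | d x y ≤ r} := by
    ext y
    rw [Metric.mem_closedBall']
    rfl
  rw [this]
  exact hd.isCompact_closedBall x r

end Topology

end IsoHull

theorem mainTheorem2 {X : Type*} [TopologicalSpace X] [PolishSpace X] [LocallyCompactSpace X]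
    [Nonempty X] (G : Subgroup (X ≃ₜ X)) (hcard : ¬ (Nat.card G = 1 ∧ Nat.card X = 2))
    (hIso1 : IsoHull.Iso1 G) (hIso2 : IsoHull.Iso2 G)
    (d : X → X → ℝ) (hd : d ∈ IsoHull.invariantMetrics G) (M : ℝ) (hM : 1 < M) :
    Dense {ρ : IsoHull.DeltaGM G d M |
      IsoHull.isometries ρ.1.toFun = IsoHull.symmetrizedTwoHull (IsoHull.mapsOf G)} ∧
    IsGδ {ρ : IsoHull.DeltaGM G d M |
      IsoHull.isometries ρ.1.toFun = IsoHull.symmetrizedTwoHull (IsoHull.mapsOf G)} :=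
  @IsoHull.dense_and_isGδ_of_metricSpace X hd.1.metricSpace hd.1.properSpace G M _ hcard hM hIso1
    hd.2
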